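/- Let $k,\ell\in\mathbb{N}$ and let $n_1,\dots,n_k,m_1,\dots,m_\ell\ge 1$ be integers. Let $A=M_{n_1}(\mathbb{C})\oplus\cdots\oplus M_{n_k}(\mathbb{C})$ and $B=M_{m_1}(\mathbb{C})\oplus\cdots\oplus M_{m_\ell}(\mathbb{C})$, and let $\varphi\colon A\to B$ be a (not necessarily unital) $*$-homomorphism. Let $E=(a_{i,j})$ be the multiplicity matrix of $\varphi$, i.e. the $\ell\times k$ matrix of nonnegative integers for which there is a unitary $\nu=(\nu_1,\dots,\nu_\ell)\in B$ such that for every $i=1,\dots,\ell$ and every $u=(u_1,\dots,u_k)\in A$ $$\nu_i\,\varphi(u)_i\,\nu_i^*=\operatorname{diag}\big(u_1^{(a_{i,1})},\dots,u_k^{(a_{i,k})},0^{(s_i)}\big),$$ where $u_j^{(a)}$ denotes $a$ diagonal copies of $u_j$ and $s_i=m_i-\sum_{j}a_{i,j}n_j$. Let $\mathrm{K}_0(\varphi)\colon \mathrm{K}_0(A)\to \mathrm{K}_0(B)$, $[p]_0\mapsto[\varphi(p)]_0$, be the induced homomorphism of $\mathrm{K}_0$-groups (Grothendieck groups of the monoids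 of Murray--von Neumann classes of projections in matrices over the algebras). Then: (a) if $\mathrm{K}_0(\varphi)$ is injective, then $\varphi$ is injective; (b) if $\varphi$ is surjective, then $\mathrm{K}_0(\varphi)$ is surjective; (c) if $\mathrm{K}_0(\varphi)$ is injective, then the following are equivalent: (i) the quotient group $\mathrm{K}_0(B)/\mathrm{K}_0(\varphi)(\mathrm{K}_0(A))$ is torsion free; (ii) the greatest common divisor of the determinants of all full square submatrices of $E$ (the square submatrices with $\min(k,\ell)$ rows) equals $1$; (iii) there is $K\in M_{k\times\ell}(\mathbb{Z})$ with $KE=I_k$. -/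

import Mathlib

/-! ### The group `K₀` of a unital C*-algebra

The definitions only use the ring structure and the involution, so they are stated for a unital
star ring `A`; for a unital C*-algebra `A` they are the standard ones. -/

namespace KTheory

section MurrayVonNeumann

variable {A : Type*} [Ring A] [StarRing A]

/-- Murray-von Neumann equivalence of square matrices over `A` of possibly different sizes:
`p = v* v` and `q = v v*` for some rectangular matrix `v` over `A`. -/
def MvN {m n : Type*} [Fintype m] [Fintype n] (p : Matrix m m A) (q : Matrix n n A) : Prop :=
  ∃ v : Matrix n m A, v.conjTranspose * v = p ∧ v * v.conjTranspose = q

theorem MvN.refl {m : Type*} [Fintype m] {p : Matrix m m A} (hp : IsStarProjection p) :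
    MvN p p := by
  have h1 : p.conjTranspose = p := hp.isSelfAdjoint
  have h2 : p * p = p := hp.isIdempotentElem
  exact ⟨p, by rw [h1, h2], by rw [h1, h2]⟩

theorem MvN.symm {m n : Type*} [Fintype m] [Fintype n] {p : Matrix m m A} {q : Matrix n n A}
    (h : MvN p q) : MvN q p := by
  obtain ⟨v, h1, h2⟩ := h
  exact ⟨v.conjTranspose, by simpa using h2, by simpa using h1⟩

theorem MvN.trans {m n l : Type*} [Fintype m] [Fintype n] [Fintype l] {p : Matrix m m A}
    {q : Matrix n n A} {r : Matrix l l A} (hp : IsStarProjection p) (hr : IsStarProjection r)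
    (h : MvN p q) (h' : MvN q r) : MvN p r := by
  obtain ⟨v, h1, h2⟩ := h
  obtain ⟨w, h3, h4⟩ := h'
  have h5 : p * p = p := hp.isIdempotentElem
  have h6 : r * r = r := hr.isIdempotentElem
  refine ⟨w * v, ?_, ?_⟩
  · calc (w * v).conjTranspose * (w * v)
        = v.conjTranspose * (w.conjTranspose * w) * v := by
          simp only [Matrix.conjTranspose_mul, Matrix.mul_assoc]
      _ = (v.conjTranspose * v) * (v.conjTranspose * v) := by
          rw [h3, ← h2]; simp only [Matrix.mul_assoc]
      _ = p := by rw [h1, h5]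
  · calc (w * v) * (w * v).conjTranspose
        = w * (v * v.conjTranspose) * w.conjTranspose := by
          simp only [Matrix.conjTranspose_mul, Matrix.mul_assoc]
      _ = (w * w.conjTranspose) * (w * w.conjTranspose) := by
          rw [h2, ← h3]; simp only [Matrix.mul_assoc]
      _ = r := by rw [h4, h6]

theorem MvN.reindex {m n : Type*} [Fintype m] [Fintype n] {p : Matrix m m A}
    (hp : IsStarProjection p) (e : m ≃ n) : MvN p (Matrix.reindex e e p) := by
  have h1 : p.conjTranspose = p := hp.isSelfAdjoint
  have h2 : p * p = p := hp.isIdempotentElem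
  refine ⟨p.submatrix e.symm id, ?_, ?_⟩
  · rw [Matrix.conjTranspose_submatrix, h1, Matrix.submatrix_mul_equiv p p id e.symm id, h2,
      Matrix.submatrix_id_id]
  · rw [Matrix.conjTranspose_submatrix, h1, ← Matrix.submatrix_mul _ _ _ _ _ Function.bijective_id,
      h2]
    rfl

theorem MvN.fromBlocks {m n m' n' : Type*} [Fintype m] [Fintype n] [Fintype m'] [Fintype n']
    {p : Matrix m m A} {q : Matrix n n A} {p' : Matrix m' m' A} {q' : Matrix n' n' A}
    (h : MvN p p') (h' : MvN q q') :
    MvN (Matrix.fromBlocks p 0 0 q) (Matrix.fromBlocks p' 0 0 q') := by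
  obtain ⟨v, h1, h2⟩ := h
  obtain ⟨w, h3, h4⟩ := h'
  refine ⟨Matrix.fromBlocks v 0 0 w, ?_, ?_⟩ <;>
    simp [Matrix.fromBlocks_conjTranspose, Matrix.fromBlocks_multiply, h1, h2, h3, h4]

theorem isStarProjection_fromBlocks {m n : Type*} [Fintype m] [Fintype n]
    {p : Matrix m m A} {q : Matrix n n A} (hp : IsStarProjection p) (hq : IsStarProjection q) :
    IsStarProjection (Matrix.fromBlocks p 0 0 q) := by
  have h1 : p.conjTranspose = p := hp.isSelfAdjoint
  have h2 : p * p = p := hp.isIdempotentElem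
  have h3 : q.conjTranspose = q := hq.isSelfAdjoint
  have h4 : q * q = q := hq.isIdempotentElem
  constructor
  · simp [IsIdempotentElem, Matrix.fromBlocks_multiply, h2, h4]
  · simp [IsSelfAdjoint, Matrix.star_eq_conjTranspose, Matrix.fromBlocks_conjTranspose, h1, h3]

theorem isStarProjection_reindex {m n : Type*} [Fintype m] [Fintype n]
    {p : Matrix m m A} (hp : IsStarProjection p) (e : m ≃ n) :
    IsStarProjection (Matrix.reindex e e p) := by
  have h1 : p.conjTranspose = p := hp.isSelfAdjoint
  have h2 : p * p = p := hp.isIdempotentElem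
  constructor
  · simp [IsIdempotentElem, Matrix.submatrix_mul_equiv, h2]
  · simp [IsSelfAdjoint, Matrix.star_eq_conjTranspose, Matrix.conjTranspose_submatrix, h1]

end MurrayVonNeumann

section K0

/-- The set `P_∞(A)` of all projections in the matrix algebras `M_n(A)`. (The size `n = 0` is
harmless: the empty matrix is equivalent to `0 ∈ M_1(A)`.) -/
abbrev ProjInf (A : Type*) [Ring A] [StarRing A] : Type _ :=
  Σ n : ℕ, {p : Matrix (Fin n) (Fin n) A // IsStarProjection p}

/-- Murray-von Neumann equivalence on `P_∞(A)`. -/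
instance projSetoid (A : Type*) [Ring A] [StarRing A] : Setoid (ProjInf A) where
  r p q := MvN p.2.1 q.2.1
  iseqv :=
    { refl := fun p => MvN.refl p.2.2
      symm := fun h => MvN.symm h
      trans := fun {p _ r} h h' => MvN.trans p.2.2 r.2.2 h h' }

/-- The monoid `D(A)` of equivalence classes of projections in `P_∞(A)`. -/
def ProjClass (A : Type*) [Ring A] [StarRing A] : Type _ := Quotient (projSetoid A)

variable {A : Type*} [Ring A] [StarRing A]

/-- The orthogonal sum `p ⊕ q = diag(p, q)` of projections. -/
def ProjInf.sum (p q : ProjInf A) : ProjInf A :=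
  ⟨p.1 + q.1, Matrix.reindex finSumFinEquiv finSumFinEquiv (Matrix.fromBlocks p.2.1 0 0 q.2.1),
    isStarProjection_reindex (isStarProjection_fromBlocks p.2.2 q.2.2) _⟩

theorem ProjInf.sum_mvn (p q : ProjInf A) :
    MvN (Matrix.fromBlocks p.2.1 0 0 q.2.1) (p.sum q).2.1 :=
  MvN.reindex (isStarProjection_fromBlocks p.2.2 q.2.2) _

theorem ProjInf.sum_congr {p q p' q' : ProjInf A} (h : MvN p.2.1 p'.2.1) (h' : MvN q.2.1 q'.2.1) :
    MvN (p.sum q).2.1 (p'.sum q').2.1 :=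
  MvN.trans (p.sum q).2.2 (p'.sum q').2.2
    (MvN.trans (p.sum q).2.2 (isStarProjection_fromBlocks p'.2.2 q'.2.2)
      (p.sum_mvn q).symm (h.fromBlocks h')) (p'.sum_mvn q')

namespace ProjClass

/-- The class in `D(A)` of a projection. -/
def mk (p : ProjInf A) : ProjClass A := Quotient.mk _ p

theorem mk_eq_iff {p q : ProjInf A} : mk p = mk q ↔ MvN p.2.1 q.2.1 :=
  Quotient.eq (r := projSetoid A)

instance : Zero (ProjClass A) := ⟨mk ⟨0, 0, IsStarProjection.zero _⟩⟩

instance : Add (ProjClass A) :=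
  ⟨Quotient.map₂ ProjInf.sum fun _ _ h _ _ h' => ProjInf.sum_congr h h'⟩

theorem mk_add_mk (p q : ProjInf A) : mk p + mk q = mk (p.sum q) := rfl

theorem zero_def : (0 : ProjClass A) = mk ⟨0, 0, IsStarProjection.zero _⟩ := rfl

theorem mk_add_comm (a b : ProjClass A) : a + b = b + a := by
  induction a using Quotient.inductionOn with | _ p
  induction b using Quotient.inductionOn with | _ q
  refine mk_eq_iff.2 ?_
  refine MvN.trans (p.sum q).2.2 (q.sum p).2.2 (p.sum_mvn q).symm
    (MvN.trans (isStarProjection_fromBlocks p.2.2 q.2.2) (q.sum p).2.2 ?_ (q.sum_mvn p))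
  have h := MvN.reindex (isStarProjection_fromBlocks p.2.2 q.2.2) (Equiv.sumComm _ _)
  simpa [Matrix.reindex_apply] using h

theorem mk_zero_add (a : ProjClass A) : 0 + a = a := by
  induction a using Quotient.inductionOn with | _ p
  refine mk_eq_iff.2 ?_
  have h := MvN.reindex (isStarProjection_fromBlocks
    (IsStarProjection.zero (Matrix (Fin 0) (Fin 0) A)) p.2.2) (Equiv.emptySum (Fin 0) (Fin p.1))
  have h1 : Matrix.reindex (Equiv.emptySum (Fin 0) (Fin p.1)) (Equiv.emptySum (Fin 0) (Fin p.1))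
      (Matrix.fromBlocks (0 : Matrix (Fin 0) (Fin 0) A) 0 0 p.2.1) = p.2.1 := by
    ext i j
    rfl
  rw [h1] at h
  exact MvN.trans (ProjInf.sum _ p).2.2 p.2.2 (ProjInf.sum_mvn _ p).symm h

theorem mk_add_assoc (a b c : ProjClass A) : a + b + c = a + (b + c) := by
  induction a using Quotient.inductionOn with | _ p
  induction b using Quotient.inductionOn with | _ q
  induction c using Quotient.inductionOn with | _ r
  refine mk_eq_iff.2 ?_
  have hL := isStarProjection_fromBlocks (isStarProjection_fromBlocks p.2.2 q.2.2) r.2.2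
  have hR := isStarProjection_fromBlocks p.2.2 (isStarProjection_fromBlocks q.2.2 r.2.2)
  have h1 : MvN (Matrix.fromBlocks (Matrix.fromBlocks p.2.1 0 0 q.2.1) 0 0 r.2.1)
      ((p.sum q).sum r).2.1 :=
    MvN.trans hL ((p.sum q).sum r).2.2
      ((p.sum_mvn q).fromBlocks (MvN.refl r.2.2)) ((p.sum q).sum_mvn r)
  have h2 : MvN (Matrix.fromBlocks p.2.1 0 0 (Matrix.fromBlocks q.2.1 0 0 r.2.1))
      (p.sum (q.sum r)).2.1 :=
    MvN.trans hR (p.sum (q.sum r)).2.2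
      ((MvN.refl p.2.2).fromBlocks (q.sum_mvn r)) (p.sum_mvn (q.sum r))
  have h3 : Matrix.reindex (Equiv.sumAssoc _ _ _) (Equiv.sumAssoc _ _ _)
      (Matrix.fromBlocks (Matrix.fromBlocks p.2.1 0 0 q.2.1) 0 0 r.2.1) =
      Matrix.fromBlocks p.2.1 0 0 (Matrix.fromBlocks q.2.1 0 0 r.2.1) := by
    ext i j
    rcases i with i | i | i <;> rcases j with j | j | j <;> rfl
  have h4 := MvN.reindex hL (Equiv.sumAssoc _ _ _)
  rw [h3] at h4
  exact MvN.trans ((p.sum q).sum r).2.2 (p.sum (q.sum r)).2.2 h1.symm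
    (MvN.trans hL (p.sum (q.sum r)).2.2 h4 h2)

instance : AddCommMonoid (ProjClass A) where
  add_assoc := mk_add_assoc
  zero_add := mk_zero_add
  add_zero a := by rw [mk_add_comm, mk_zero_add]
  add_comm := mk_add_comm
  nsmul := nsmulRec

end ProjClass

/-- `K₀(A)`: the Grothendieck group of `D(A)`. -/
abbrev K0 (A : Type*) [Ring A] [StarRing A] : Type _ := Algebra.GrothendieckAddGroup (ProjClass A)

/-- The class `[p]₀ ∈ K₀(A)` of a projection `p ∈ P_∞(A)`. -/
def K0.cls (p : ProjInf A) : K0 A := Algebra.GrothendieckAddGroup.of (ProjClass.mk p)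

end K0

section Functoriality

variable {A B : Type*} [Ring A] [StarRing A] [Algebra ℂ A] [Ring B] [StarRing B] [Algebra ℂ B]

theorem map_conjTranspose (φ : A →⋆ₙₐ[ℂ] B) {m n : Type*} (v : Matrix m n A) :
    (v.map φ).conjTranspose = v.conjTranspose.map φ := by
  ext i j
  simp [Matrix.conjTranspose_apply, map_star]

/-- The entrywise image `φ(p) ∈ P_∞(B)` of `p ∈ P_∞(A)` under a (not necessarily unital)
*-homomorphism. -/
def ProjInf.map (φ : A →⋆ₙₐ[ℂ] B) (p : ProjInf A) : ProjInf B :=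
  ⟨p.1, p.2.1.map φ, by
    have h1 : p.2.1.conjTranspose = p.2.1 := p.2.2.isSelfAdjoint
    have h2 : p.2.1 * p.2.1 = p.2.1 := p.2.2.isIdempotentElem
    constructor
    · rw [IsIdempotentElem, ← Matrix.map_mul, h2]
    · rw [IsSelfAdjoint, Matrix.star_eq_conjTranspose, map_conjTranspose, h1]⟩

theorem MvN.map (φ : A →⋆ₙₐ[ℂ] B) {m n : Type*} [Fintype m] [Fintype n] {p : Matrix m m A}
    {q : Matrix n n A} (h : MvN p q) : MvN (p.map φ) (q.map φ) := by
  obtain ⟨v, h1, h2⟩ := h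
  exact ⟨v.map φ, by rw [map_conjTranspose, ← Matrix.map_mul, h1],
    by rw [map_conjTranspose, ← Matrix.map_mul, h2]⟩

/-- The additive map `D(A) → D(B)`, `[p] ↦ [φ(p)]`. -/
def ProjClass.map (φ : A →⋆ₙₐ[ℂ] B) : ProjClass A →+ ProjClass B where
  toFun := Quotient.map (ProjInf.map φ) fun _ _ h => MvN.map φ h
  map_zero' := by
    refine ProjClass.mk_eq_iff.2 ?_
    exact ⟨(0 : Matrix (Fin 0) (Fin 0) B), Matrix.ext fun i => i.elim0, Matrix.ext fun i => i.elim0⟩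
  map_add' a b := by
    induction a using Quotient.inductionOn with | _ p
    induction b using Quotient.inductionOn with | _ q
    refine congrArg ProjClass.mk ?_
    refine Sigma.ext rfl (heq_of_eq (Subtype.ext ?_))
    change (Matrix.reindex finSumFinEquiv finSumFinEquiv
        (Matrix.fromBlocks p.2.1 0 0 q.2.1)).map φ = Matrix.reindex finSumFinEquiv finSumFinEquiv
        (Matrix.fromBlocks (p.2.1.map φ) 0 0 (q.2.1.map φ))
    rw [Matrix.reindex_apply, Matrix.reindex_apply, ← Matrix.submatrix_map, Matrix.fromBlocks_map]
    simp [Matrix.map_zero]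

/-- The group homomorphism `K₀(φ) : K₀(A) → K₀(B)`, determined by `K₀(φ)[p]₀ = [φ(p)]₀`. -/
noncomputable def K0.map (φ : A →⋆ₙₐ[ℂ] B) : K0 A →+ K0 B :=
  Algebra.GrothendieckAddGroup.lift
    ((Algebra.GrothendieckAddGroup.of (M := ProjClass B)).comp (ProjClass.map φ))

theorem K0.map_cls (φ : A →⋆ₙₐ[ℂ] B) (p : ProjInf A) :
    K0.map φ (K0.cls p) = K0.cls (p.map φ) :=
  DFunLike.congr_fun (Algebra.GrothendieckAddGroup.lift.left_inv
    ((Algebra.GrothendieckAddGroup.of (M := ProjClass B)).comp (ProjClass.map φ)))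
    (ProjClass.mk p)

end Functoriality

/-! ### Finite-dimensional C*-algebras and multiplicity matrices -/

/-- The finite-dimensional C*-algebra `M_{n_1}(ℂ) ⊕ ⋯ ⊕ M_{n_k}(ℂ)`, with componentwise operations
and involution (its unique C*-norm plays no role). -/
abbrev MatrixSum {k : ℕ} (n : Fin k → ℕ) : Type :=
  ∀ j : Fin k, Matrix (Fin (n j)) (Fin (n j)) ℂ

/-- `E` is the multiplicity matrix of the *-homomorphism `φ`: there is a unitary
`ν = (ν_1, …, ν_ℓ)` of the codomain such that for all `i` and all `u = (u_1, …, u_k)`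
`ν_i φ_i(u) ν_i* = diag(u_1^{(E i 1)}, …, u_k^{(E i k)}, 0^{(s)})`,
where `u_j^{(a)}` stands for `a` diagonal copies of `u_j`. The bijection `e` lists the
basis vectors of the blocks; its choice only changes `ν_i` by a permutation matrix. -/
def IsMultiplicityMatrix {k l : ℕ} {n : Fin k → ℕ} {m : Fin l → ℕ}
    (φ : MatrixSum n →⋆ₙₐ[ℂ] MatrixSum m) (E : Matrix (Fin l) (Fin k) ℕ) : Prop :=
  ∃ ν ∈ unitary (MatrixSum m), ∀ i : Fin l,
    ∃ (s : ℕ) (e : ((Σ j : Fin k, Fin (n j) × Fin (E i j)) ⊕ Fin s) ≃ Fin (m i)),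
      ∀ u : MatrixSum n,
        ν i * φ u i * star (ν i) = Matrix.reindex e e
          (Matrix.fromBlocks
            (Matrix.blockDiagonal' fun j => Matrix.blockDiagonal fun _ : Fin (E i j) => u j)
            0 0 0)

open Classical in
/-- The greatest common divisor (taken to be nonnegative) of the determinants of the full square
submatrices of an integer matrix `E`, i.e. of the square submatrices with
`min(number of rows, number of columns)` rows; `r` and `c` list the chosen rows and columns
in increasing order. -/
noncomputable def gcdFullMinors {l k : ℕ} (E : Matrix (Fin l) (Fin k) ℤ) : ℤ :=
  (Finset.univ : Finset ({r : Fin (min l k) → Fin l // StrictMono r} ×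
    {c : Fin (min l k) → Fin k // StrictMono c})).gcd fun rc => (E.submatrix rc.1.1 rc.2.1).det

end KTheory

/-! ### Integer matrices with torsion-free cokernel -/

namespace Matrix

/-! Projections in matrices over `MatrixSum n` are classified up to Murray–von Neumann equivalence
by the traces of their components, because a complex projection is determined up to equivalence by
its rank. Hence the traces identify the `K0` groups with `ℤ^k` and `ℤ^l` (`K0.exists_equiv`). Since
the trace is unitarily invariant, `K0.map φ` becomes multiplication by the multiplicity matrix
(`IsMultiplicityMatrix.exists_equiv`), and (c) turns into a statement about integer matrices.

For that statement, a finitely generated torsion-free cokernel is free, so the range splits off and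
a left inverse exists. A left inverse survives reduction modulo every prime, so no prime divides all
full minors. If the full minors are coprime, Cramer's rule shows that any `a ≠ 0` with `a • y = E x`
divides `x`, so `y` is already in the range.

Parts (a) and (b) do not use the multiplicity matrix. Since matrix algebras are simple, the kernel
of `φ` is a sum of full summands. If it contained one, the nonzero class of that summand's unit
would die in `K0`. If `φ` is onto, the complementary summands map isomorphically onto the codomain,
so `φ` has a *-homomorphic section and functoriality gives surjectivity. -/

/-- An integer matrix that is injective with torsion-free cokernel has a left inverse. -/
theorem exists_mul_eq_one_of_smul_mem_range {k l : ℕ} {E : Matrix (Fin l) (Fin k) ℤ}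
    (hinj : Function.Injective E.mulVec)
    (hE : ∀ (a : ℤ) (y : Fin l → ℤ) (x : Fin k → ℤ), a ≠ 0 → a • y = E.mulVec x →
      ∃ z, y = E.mulVec z) :
    ∃ K : Matrix (Fin k) (Fin l) ℤ, K * E = 1 := by
  set f := E.mulVecLin with hf
  have hfinj : Function.Injective f := hinj
  have htf : IsAddTorsionFree ((Fin l → ℤ) ⧸ LinearMap.range f) := by
    rw [← Module.isTorsionFree_int_iff_isAddTorsionFree]
    rw [Module.isTorsionFree_iff_smul_eq_zero]
    intro a q haq
    induction q using Submodule.Quotient.induction_on with | _ y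
    rw [← Submodule.Quotient.mk_smul, Submodule.Quotient.mk_eq_zero] at haq
    obtain ⟨x, hx⟩ := haq
    by_cases ha : a = 0
    · exact Or.inl ha
    · obtain ⟨z, hz⟩ := hE a y x ha hx.symm
      exact Or.inr ((Submodule.Quotient.mk_eq_zero _).2 ⟨z, hz.symm⟩)
  -- The quotient is finitely generated and torsion free over `ℤ`, hence free and projective, so the
  -- quotient map has a section `s`. Then `id - s ∘ mkQ` is a projection onto the range of `f`, and
  -- following it by the inverse of `f` on its range gives the left inverse.
  obtain ⟨s, hs⟩ := Module.projective_lifting_property (LinearMap.range f).mkQ LinearMap.id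
    (Submodule.mkQ_surjective _)
  have hmem (y : Fin l → ℤ) :
      (LinearMap.id - s ∘ₗ (LinearMap.range f).mkQ : (Fin l → ℤ) →ₗ[ℤ] (Fin l → ℤ)) y ∈ LinearMap.range f := by
    rw [← Submodule.Quotient.mk_eq_zero, ← Submodule.mkQ_apply, LinearMap.sub_apply, map_sub,
      sub_eq_zero]
    exact (LinearMap.congr_fun hs ((LinearMap.range f).mkQ y)).symm
  let g : (Fin l → ℤ) →ₗ[ℤ] (Fin k → ℤ) :=
    (LinearEquiv.ofInjective f hfinj).symm.toLinearMap ∘ₗ LinearMap.codRestrict _ _ hmem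
  have hg : g ∘ₗ f = LinearMap.id := by
    refine LinearMap.ext fun x => ?_
    refine (LinearEquiv.ofInjective f hfinj).injective (Subtype.ext ?_)
    have : (Submodule.Quotient.mk (f x) : (Fin l → ℤ) ⧸ LinearMap.range f) = 0 :=
      (Submodule.Quotient.mk_eq_zero _).2 ⟨x, rfl⟩
    simp [g, this]
  refine ⟨LinearMap.toMatrix' g, ?_⟩
  have h := congrArg LinearMap.toMatrix' hg
  rwa [LinearMap.toMatrix'_comp, LinearMap.toMatrix'_id, hf, ← Matrix.toLin'_apply',
    LinearMap.toMatrix'_toLin'] at h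

/-- A matrix over a field with a left inverse has a nonzero maximal minor. -/
theorem exists_strictMono_det_ne_zero {F : Type*} [Field F] {k l : ℕ}
    {E : Matrix (Fin l) (Fin k) F} {K : Matrix (Fin k) (Fin l) F} (h : K * E = 1) :
    ∃ r : Fin k → Fin l, StrictMono r ∧ (E.submatrix r id).det ≠ 0 := by
  have hspan : Submodule.span F (Set.range E.row) = ⊤ := by
    rw [eq_top_iff, ← (Pi.basisFun F (Fin k)).span_eq, Submodule.span_le]
    rintro _ ⟨i, rfl⟩
    have : Pi.basisFun F (Fin k) i = ∑ j, K i j • E.row j := by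
      ext c
      have := congrFun (congrFun h i) c
      simp only [Matrix.mul_apply] at this
      simp [this, Matrix.one_apply, Pi.single_apply, Finset.sum_apply, eq_comm]
    rw [this]
    exact Submodule.sum_mem _ fun j _ =>
      Submodule.smul_mem _ _ (Submodule.subset_span ⟨j, rfl⟩)
  -- The rows of `E` span, so some of them form a basis, and there are `k` of these.
  obtain ⟨κ, a, ha, hsp, hli⟩ := exists_linearIndependent' F E.row
  have : Finite κ := Finite.of_injective a ha
  cases nonempty_fintype κ
  have hcard : Fintype.card κ = k := by
    have hb := Module.finrank_eq_card_basis
      (Module.Basis.mk hli (by rw [hsp, hspan]))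
    simpa using hb.symm
  let e : Fin k ≃ κ := (Fintype.equivFinOfCardEq hcard).symm
  let r₀ : Fin k → Fin l := a ∘ e
  have hr₀ : Function.Injective r₀ := ha.comp e.injective
  -- Full minors are indexed by increasing tuples; sorting the chosen rows preserves their
  -- independence.
  let σ := Tuple.sort r₀
  refine ⟨r₀ ∘ σ, (Tuple.monotone_sort r₀).strictMono_of_injective
    (hr₀.comp σ.injective), ?_⟩
  have hli' : LinearIndependent F (E.submatrix (r₀ ∘ σ) id).row :=
    hli.comp (e ∘ σ) (e.injective.comp σ.injective)
  exact ((Matrix.isUnit_iff_isUnit_det _).1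
    (Matrix.linearIndependent_rows_iff_isUnit.1 hli')).ne_zero

end Matrix

/-! ### Coprime full minors -/

namespace KTheory

theorem gcdFullMinors_dvd {k l : ℕ} (E : Matrix (Fin l) (Fin k) ℤ)
    {r : Fin (min l k) → Fin l} {c : Fin (min l k) → Fin k} (hr : StrictMono r)
    (hc : StrictMono c) : gcdFullMinors E ∣ (E.submatrix r c).det :=
  Finset.gcd_dvd (Finset.mem_univ
    (⟨⟨r, hr⟩, ⟨c, hc⟩⟩ : {r : Fin (min l k) → Fin l // StrictMono r} ×
      {c : Fin (min l k) → Fin k // StrictMono c}))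

/-- The full minors of an integer matrix with a left inverse are coprime. -/
theorem gcdFullMinors_eq_one_of_mul_eq_one {k l : ℕ} (hkl : k ≤ l) {E : Matrix (Fin l) (Fin k) ℤ}
    {K : Matrix (Fin k) (Fin l) ℤ} (h : K * E = 1) : gcdFullMinors E = 1 := by
  have hnorm : normalize (gcdFullMinors E) = gcdFullMinors E := Finset.normalize_gcd
  rw [← hnorm, normalize_eq_one]
  by_contra hu
  obtain ⟨p, hp, hpd⟩ := Int.exists_prime_and_dvd (n := gcdFullMinors E)
    (fun h1 => hu (Int.isUnit_iff_natAbs_eq.2 h1))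
  have : Fact p.natAbs.Prime := ⟨Int.prime_iff_natAbs_prime.1 hp⟩
  let ρ := Int.castRingHom (ZMod p.natAbs)
  have hρ : K.map ρ * E.map ρ = 1 := by
    rw [← Matrix.map_mul, h, Matrix.map_one _ (map_zero ρ) (map_one ρ)]
  obtain ⟨r, hr, hdet⟩ := Matrix.exists_strictMono_det_ne_zero hρ
  have hmin : min l k = k := min_eq_right hkl
  -- All columns are taken, in order; only the index type changes, along `min l k = k`.
  have hc : StrictMono (finCongr hmin) := fun _ _ hab => hab
  have hd := hpd.trans (gcdFullMinors_dvd E (hr.comp hc) hc)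
  have hsub : E.submatrix (r ∘ finCongr hmin) (finCongr hmin) =
      (E.submatrix r id).submatrix (finCongr hmin) (finCongr hmin) := rfl
  rw [hsub, Matrix.det_submatrix_equiv_self] at hd
  apply hdet
  have h0 : ρ (E.submatrix r id).det = 0 :=
    (ZMod.intCast_zmod_eq_zero_iff_dvd _ _).2 (Int.natAbs_dvd.2 hd)
  rw [RingHom.map_det] at h0
  exact h0

/-- If the full minors of an integer matrix are coprime, its cokernel is torsion free. -/
theorem exists_eq_mulVec_of_gcdFullMinors_eq_one {k l : ℕ} (hkl : k ≤ l)
    {E : Matrix (Fin l) (Fin k) ℤ} (hE : gcdFullMinors E = 1) {a : ℤ} (ha : a ≠ 0)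
    {y : Fin l → ℤ} {x : Fin k → ℤ} (h : a • y = E.mulVec x) : ∃ z, y = E.mulVec z := by
  have hdvd (j : Fin k) : a ∣ x j := by
    -- It suffices that `a` divides each full minor times `x j`; `normalize` appears when the factor
    -- is moved inside the gcd.
    have h1 : a ∣ gcdFullMinors E * normalize (x j) := by
      unfold gcdFullMinors
      rw [← Finset.gcd_mul_right]
      refine Finset.dvd_gcd ?_
      rintro ⟨⟨r, hr⟩, ⟨c, hc⟩⟩ -
      have hcb : Function.Bijective c := by
        rw [Fintype.bijective_iff_injective_and_card]
        exact ⟨hc.injective, by simp [hkl]⟩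
      obtain ⟨j, rfl⟩ := hcb.2 j
      set S := E.submatrix r c
      have h2 : a • (y ∘ r) = S.mulVec (x ∘ c) := by
        ext i
        have h3 := congrFun h (r i)
        simp only [Matrix.mulVec, dotProduct] at h3
        simp only [Matrix.mulVec, dotProduct, S, Matrix.submatrix_apply, Function.comp_apply]
        exact h3.trans
          (Equiv.sum_comp (Equiv.ofBijective c hcb) (fun t => E (r i) t * x t)).symm
      -- Cramer's rule: applying the adjugate to `a • (y ∘ r) = S (x ∘ c)` leaves `det S` times `x ∘
      -- c` on the right.
      have h4 := congrFun (congrArg S.adjugate.mulVec h2) j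
      rw [Matrix.mulVec_mulVec, Matrix.adjugate_mul, Matrix.mulVec_smul, Matrix.smul_mulVec,
        Matrix.one_mulVec] at h4
      exact ⟨_, h4.symm⟩
    rwa [hE, one_mul, dvd_normalize_iff] at h1
  choose z hz using hdvd
  refine ⟨z, ?_⟩
  have hx : x = a • z := funext hz
  rw [hx, Matrix.mulVec_smul] at h
  exact smul_right_injective _ ha h

end KTheory

/-! ### `K₀` of a finite-dimensional C*-algebra -/

namespace KTheory

/-- The trace is an invariant of Murray-von Neumann equivalence. -/
theorem MvN.trace_eq {ι κ : Type*} [Fintype ι] [Fintype κ] {P : Matrix ι ι ℂ}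
    {Q : Matrix κ κ ℂ} (h : MvN P Q) : P.trace = Q.trace := by
  obtain ⟨v, rfl, rfl⟩ := h
  exact Matrix.trace_mul_comm _ _

/-- A complex projection is equivalent to an identity matrix. -/
theorem exists_mvN_one {ι : Type*} [Fintype ι] {P : Matrix ι ι ℂ} (hP : IsStarProjection P) :
    ∃ r : ℕ, MvN P (1 : Matrix (Fin r) (Fin r) ℂ) := by
  classical
  have hH : P.IsHermitian := hP.isSelfAdjoint
  have hPP : P * P = P := hP.isIdempotentElem
  set U : Matrix ι ι ℂ := hH.eigenvectorUnitary.1 with hU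
  have hUU : U.conjTranspose * U = 1 := Unitary.coe_star_mul_self hH.eigenvectorUnitary
  set D : Matrix ι ι ℂ := Matrix.diagonal (RCLike.ofReal ∘ hH.eigenvalues) with hD
  have hspec : P = U * D * U.conjTranspose := by
    have := hH.spectral_theorem
    rwa [Unitary.conjStarAlgAut_apply] at this
  have hDP : D = U.conjTranspose * P * U := by
    rw [hspec]
    simp only [Matrix.mul_assoc, hUU, Matrix.mul_one]
    rw [← Matrix.mul_assoc, hUU, Matrix.one_mul]
  have hDD : D * D = D := by
    have hUU' : U * U.conjTranspose = 1 := Unitary.coe_mul_star_self hH.eigenvectorUnitary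
    calc D * D = U.conjTranspose * P * (U * U.conjTranspose) * P * U := by
          rw [hDP]; simp only [Matrix.mul_assoc]
      _ = U.conjTranspose * (P * P) * U := by
          rw [hUU']; simp only [Matrix.mul_assoc, Matrix.one_mul]
      _ = D := by rw [hPP, hDP]
  have hev (i : ι) : hH.eigenvalues i = 0 ∨ hH.eigenvalues i = 1 := by
    have h1 := congrFun (congrFun hDD i) i
    rw [hD, Matrix.diagonal_mul_diagonal, Matrix.diagonal_apply_eq, Matrix.diagonal_apply_eq] at h1
    have h2 : hH.eigenvalues i * hH.eigenvalues i = hH.eigenvalues i := by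
      simp only [Function.comp_apply] at h1
      exact_mod_cast h1
    exact IsIdempotentElem.iff_eq_zero_or_one.1 h2
  -- The partial isometry consists of the columns of `U` that are eigenvectors for the eigenvalue
  -- `1`.
  let e := Fintype.equivFin {i // hH.eigenvalues i = 1}
  refine ⟨Fintype.card {i // hH.eigenvalues i = 1},
    MvN.trans hP (IsStarProjection.one _) (MvN.symm (p := (1 : Matrix
      {i // hH.eigenvalues i = 1} {i // hH.eigenvalues i = 1} ℂ))
      ⟨U.submatrix id Subtype.val, ?_, ?_⟩) ?_⟩
  · rw [Matrix.conjTranspose_submatrix,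
      ← Matrix.submatrix_mul _ _ _ _ _ Function.bijective_id, hUU,
      Matrix.submatrix_one _ Subtype.val_injective]
  · refine Eq.trans ?_ hspec.symm
    ext x y
    rw [Matrix.mul_apply, Matrix.mul_apply]
    simp only [Matrix.submatrix_apply, id_eq, Matrix.conjTranspose_apply, hD,
      Matrix.mul_diagonal, Function.comp_apply]
    rw [← Finset.sum_subtype (Finset.univ.filter fun i => hH.eigenvalues i = 1) (by simp)
      (fun i => U x i * star (U y i)), Finset.sum_filter]
    refine Finset.sum_congr rfl fun i _ => ?_
    rcases hev i with h | h <;> simp [h]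
  · have := MvN.reindex (A := ℂ) (p := (1 : Matrix
      {i // hH.eigenvalues i = 1} {i // hH.eigenvalues i = 1} ℂ)) (IsStarProjection.one _) e
    simpa using this

/-- Complex projections with the same trace are equivalent. -/
theorem mvN_of_trace_eq {ι κ : Type*} [Fintype ι] [Fintype κ] {P : Matrix ι ι ℂ}
    {Q : Matrix κ κ ℂ} (hP : IsStarProjection P) (hQ : IsStarProjection Q)
    (h : P.trace = Q.trace) : MvN P Q := by
  obtain ⟨r, hr⟩ := exists_mvN_one hP
  obtain ⟨s, hs⟩ := exists_mvN_one hQ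
  have hrs : r = s := by
    have := hr.trace_eq.symm.trans (h.trans hs.trace_eq)
    simpa using this
  subst hrs
  exact MvN.trans hP hQ hr hs.symm

/-! ### Reduction to complex matrices, one summand at a time -/

section Blocks

variable {k : ℕ} {n : Fin k → ℕ} {ι κ μ : Type*}

/-- The `j`-th component of a matrix over `M_{n_1}(ℂ) ⊕ ⋯ ⊕ M_{n_k}(ℂ)`, as a complex matrix. -/
def block (j : Fin k) (v : Matrix ι κ (MatrixSum n)) :
    Matrix (ι × Fin (n j)) (κ × Fin (n j)) ℂ :=
  Matrix.of fun x y => v x.1 y.1 j x.2 y.2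

theorem block_mul [Fintype κ] (j : Fin k) (v : Matrix ι κ (MatrixSum n))
    (w : Matrix κ μ (MatrixSum n)) : block j (v * w) = block j v * block j w := by
  ext x y
  simp [block, Matrix.mul_apply, Finset.sum_apply, Matrix.sum_apply, Fintype.sum_prod_type]

theorem block_conjTranspose (j : Fin k) (v : Matrix ι κ (MatrixSum n)) :
    block j v.conjTranspose = (block j v).conjTranspose := by
  ext x y
  simp [block, Matrix.conjTranspose_apply]

theorem block_injective {v w : Matrix ι κ (MatrixSum n)} (h : ∀ j, block j v = block j w) :
    v = w := by
  ext x y j a b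
  exact congrFun (congrFun (h j) (x, a)) (y, b)

theorem trace_block [Fintype ι] (j : Fin k) (p : Matrix ι ι (MatrixSum n)) :
    (block j p).trace = (p.trace j).trace := by
  simp [block, Matrix.trace, Fintype.sum_prod_type, Finset.sum_apply, Matrix.sum_apply]
  rw [Finset.sum_comm]

theorem isStarProjection_block [Fintype ι] {p : Matrix ι ι (MatrixSum n)}
    (hp : IsStarProjection p) (j : Fin k) : IsStarProjection (block j p) := by
  have h1 : p.conjTranspose = p := hp.isSelfAdjoint
  have h2 : p * p = p := hp.isIdempotentElem
  constructor
  · rw [IsIdempotentElem, ← block_mul, h2]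
  · rw [IsSelfAdjoint, Matrix.star_eq_conjTranspose, ← block_conjTranspose, h1]

/-- Taking blocks respects products and adjoints, and a family of blocks determines a unique matrix
over the direct sum. The question thus splits into complex ones, where equal trace means equal rank.
-/
theorem mvN_iff_trace_eq [Fintype ι] [Fintype κ] {p : Matrix ι ι (MatrixSum n)}
    {q : Matrix κ κ (MatrixSum n)} (hp : IsStarProjection p) (hq : IsStarProjection q) :
    MvN p q ↔ ∀ j, (p.trace j).trace = (q.trace j).trace := by
  constructor
  · rintro ⟨v, h1, h2⟩ j
    rw [← trace_block, ← trace_block]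
    exact MvN.trace_eq ⟨block j v, by rw [← block_conjTranspose, ← block_mul, h1],
      by rw [← block_conjTranspose, ← block_mul, h2]⟩
  · intro h
    have h' (j : Fin k) : MvN (block j p) (block j q) :=
      mvN_of_trace_eq (isStarProjection_block hp j) (isStarProjection_block hq j)
        (by rw [trace_block, trace_block, h j])
    choose w hw1 hw2 using h'
    -- The partial isometries chosen for the separate summands are reassembled into one matrix over
    -- the direct sum.
    let v : Matrix κ ι (MatrixSum n) := fun x y j => Matrix.of fun a b => w j (x, a) (y, b)
    have hv (j : Fin k) : block j v = w j := rfl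
    exact ⟨v, block_injective fun j => by rw [block_mul, block_conjTranspose, hv, hw1],
      block_injective fun j => by rw [block_mul, block_conjTranspose, hv, hw2]⟩

end Blocks

section Trace

variable {k : ℕ} {n : Fin k → ℕ}

/-- The map `[p] ↦ (tr p_1, …, tr p_k)` on equivalence classes of projections. -/
noncomputable def ProjClass.trace (n : Fin k → ℕ) :
    ProjClass (MatrixSum n) →+ (Fin k → ℂ) where
  toFun := Quotient.lift (fun p j => (p.2.1.trace j).trace)
    fun p q h => funext ((mvN_iff_trace_eq p.2.2 q.2.2).1 h)
  map_zero' := by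
    ext j
    change Matrix.trace (Matrix.trace (0 : Matrix (Fin 0) (Fin 0) (MatrixSum n)) j) = 0
    simp
  map_add' a b := by
    induction a using Quotient.inductionOn with | _ p
    induction b using Quotient.inductionOn with | _ q
    ext j
    change ((p.sum q).2.1.trace j).trace = (p.2.1.trace j).trace + (q.2.1.trace j).trace
    have h : (p.sum q).2.1.trace = p.2.1.trace + q.2.1.trace := by
      change ∑ i, Matrix.fromBlocks p.2.1 0 0 q.2.1 (finSumFinEquiv.symm i)
        (finSumFinEquiv.symm i) = _
      rw [Equiv.sum_comp finSumFinEquiv.symm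
        fun i => Matrix.fromBlocks p.2.1 0 0 q.2.1 i i, Fintype.sum_sum_type]
      rfl
    rw [h, Pi.add_apply, Matrix.trace_add]

theorem ProjClass.trace_mk (p : ProjInf (MatrixSum n)) (j : Fin k) :
    ProjClass.trace n (ProjClass.mk p) j = (p.2.1.trace j).trace := rfl

theorem ProjClass.trace_injective : Function.Injective (ProjClass.trace n) := by
  intro a b h
  induction a using Quotient.inductionOn with | _ p
  induction b using Quotient.inductionOn with | _ q
  exact ProjClass.mk_eq_iff.2 ((mvN_iff_trace_eq p.2.2 q.2.2).2 (congrFun h))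

end Trace

/-! ### The trace isomorphism from the `K0` group to `ℤ^k` -/

section K0

theorem K0.exists_eq_sub {A : Type*} [Ring A] [StarRing A] (x : K0 A) :
    ∃ p q : ProjInf A, x = K0.cls p - K0.cls q := by
  obtain ⟨⟨a, b⟩, h⟩ := (AddLocalization.addMonoidOf (⊤ : AddSubmonoid (ProjClass A))).surj x
  obtain ⟨p, rfl⟩ := Quotient.exists_rep a
  obtain ⟨⟨b', hb'⟩, rfl⟩ : ∃ b', b = b' := ⟨b, rfl⟩
  obtain ⟨q, rfl⟩ := Quotient.exists_rep b'
  exact ⟨p, q, eq_sub_of_add_eq h⟩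

theorem K0.hom_ext {A : Type*} [Ring A] [StarRing A] {G : Type*} [AddCommGroup G]
    {f g : K0 A →+ G} (h : ∀ p, f (K0.cls p) = g (K0.cls p)) : f = g := by
  ext x
  obtain ⟨p, q, rfl⟩ := K0.exists_eq_sub x
  rw [map_sub, map_sub, h, h]

variable {k : ℕ} {n : Fin k → ℕ}

/-- The homomorphism `K₀(A) → ℂ^k`, `[p]₀ ↦ (tr p_1, …, tr p_k)`. -/
noncomputable def K0.trace (n : Fin k → ℕ) : K0 (MatrixSum n) →+ (Fin k → ℂ) :=
  Algebra.GrothendieckAddGroup.lift (ProjClass.trace n)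

theorem K0.trace_cls (p : ProjInf (MatrixSum n)) (j : Fin k) :
    K0.trace n (K0.cls p) j = (p.2.1.trace j).trace :=
  congrFun (DFunLike.congr_fun (Algebra.GrothendieckAddGroup.lift.left_inv (ProjClass.trace n))
    (ProjClass.mk p)) j

theorem K0.trace_injective : Function.Injective (K0.trace n) := by
  rw [injective_iff_map_eq_zero]
  intro x hx
  obtain ⟨p, q, rfl⟩ := K0.exists_eq_sub x
  rw [map_sub, sub_eq_zero] at hx
  have h : ProjClass.mk p = ProjClass.mk q := ProjClass.trace_injective <| funext fun j => by
    rw [ProjClass.trace_mk, ProjClass.trace_mk, ← K0.trace_cls, ← K0.trace_cls, hx]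
  rw [K0.cls, K0.cls, h, sub_self]

/-- A projection of `A`, as a `1 × 1` matrix. -/
def ProjInf.single {A : Type*} [Ring A] [StarRing A] (a : A) (ha : IsStarProjection a) :
    ProjInf A :=
  ⟨1, Matrix.of fun _ _ => a, by
    have h1 : star a = a := ha.isSelfAdjoint
    have h2 : a * a = a := ha.isIdempotentElem
    constructor
    · ext i j
      simp [Matrix.mul_apply, h2]
    · ext i j
      simp [Matrix.star_apply, h1]⟩

theorem K0.trace_cls_single {a : MatrixSum n} (ha : IsStarProjection a) (j : Fin k) :
    K0.trace n (K0.cls (ProjInf.single a ha)) j = (a j).trace := by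
  rw [K0.trace_cls]
  exact congrArg (fun b : MatrixSum n => (b j).trace) (Fin.sum_univ_one _)

theorem isStarProjection_piSingle {j : Fin k} {a : Matrix (Fin (n j)) (Fin (n j)) ℂ}
    (ha : IsStarProjection a) : IsStarProjection (Pi.single j a : MatrixSum n) := by
  have h1 : star a = a := ha.isSelfAdjoint
  have h2 : a * a = a := ha.isIdempotentElem
  constructor
  · rw [IsIdempotentElem, ← Pi.single_mul, h2]
  · rw [IsSelfAdjoint, ← Pi.single_star, h1]

theorem isStarProjection_single_one {ι : Type*} [Fintype ι] [DecidableEq ι] (i : ι) :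
    IsStarProjection (Matrix.single i i (1 : ℂ)) := by
  constructor
  · simp [IsIdempotentElem]
  · simp [IsSelfAdjoint, Matrix.star_eq_conjTranspose]

/-- A rank-one projection in the `j`-th summand does this; it exists because `n j` is positive. -/
theorem K0.exists_trace_eq_single (hn : ∀ j, 0 < n j) (j : Fin k) :
    ∃ x, K0.trace n x = Pi.single j 1 := by
  refine ⟨K0.cls (ProjInf.single _
    (isStarProjection_piSingle (isStarProjection_single_one (⟨0, hn j⟩ : Fin (n j))))), ?_⟩
  ext i
  rw [K0.trace_cls_single]
  by_cases h : i = j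
  · subst h
    simp
  · simp [h]

/-- The trace of a complex projection is its rank, and every class is a difference of classes of
projections. -/
theorem K0.exists_trace_eq_intCast (x : K0 (MatrixSum n)) :
    ∃ z : Fin k → ℤ, K0.trace n x = fun j => (z j : ℂ) := by
  have key (p : ProjInf (MatrixSum n)) (j : Fin k) :
      ∃ r : ℕ, K0.trace n (K0.cls p) j = r := by
    obtain ⟨r, hr⟩ := exists_mvN_one (isStarProjection_block p.2.2 j)
    refine ⟨r, ?_⟩
    rw [K0.trace_cls, ← trace_block, hr.trace_eq]
    simp
  obtain ⟨p, q, rfl⟩ := K0.exists_eq_sub x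
  choose r hr using key p
  choose s hs using key q
  refine ⟨fun j => r j - s j, ?_⟩
  ext j
  simp [hr, hs]

/-- `K₀(M_{n_1}(ℂ) ⊕ ⋯ ⊕ M_{n_k}(ℂ))` is isomorphic to `ℤ^k` through the traces. -/
theorem K0.exists_equiv (hn : ∀ j, 0 < n j) :
    ∃ S : (Fin k → ℤ) ≃+ K0 (MatrixSum n), ∀ z j, K0.trace n (S z) j = z j := by
  choose x hx using K0.exists_trace_eq_single hn
  let S : (Fin k → ℤ) →+ K0 (MatrixSum n) :=
    ∑ j, (zmultiplesHom _ (x j)).comp (Pi.evalAddMonoidHom (fun _ => ℤ) j)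
  have hS (z) (j) : K0.trace n (S z) j = z j := by
    simp [S, hx, Finset.sum_apply, Pi.single_apply]
  refine ⟨AddEquiv.ofBijective S ⟨fun z w h => ?_, fun y => ?_⟩, hS⟩
  · ext j
    have h1 := hS z j
    rw [h, hS] at h1
    exact_mod_cast h1.symm
  · obtain ⟨z, hz⟩ := K0.exists_trace_eq_intCast y
    exact ⟨z, K0.trace_injective (by ext j; rw [hS, hz])⟩

end K0

end KTheory

/-! ### Homomorphisms of finite-dimensional C*-algebras and their multiplicity matrices -/

namespace KTheory

section Functoriality

variable {A B C : Type*} [Ring A] [StarRing A] [Algebra ℂ A] [Ring B] [StarRing B] [Algebra ℂ B]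
  [Ring C] [StarRing C] [Algebra ℂ C]

theorem K0.map_comp (ψ : B →⋆ₙₐ[ℂ] C) (φ : A →⋆ₙₐ[ℂ] B) :
    K0.map (ψ.comp φ) = (K0.map ψ).comp (K0.map φ) :=
  K0.hom_ext fun p => by
    rw [AddMonoidHom.comp_apply, K0.map_cls, K0.map_cls, K0.map_cls]
    rfl

theorem K0.map_id : K0.map (NonUnitalStarAlgHom.id ℂ A) = AddMonoidHom.id (K0 A) :=
  K0.hom_ext fun p => by
    rw [K0.map_cls]
    rfl

end Functoriality

/-! ### Kernels, sections and multiplicity matrices -/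

variable {k l : ℕ} {n : Fin k → ℕ} {m : Fin l → ℕ}

/-- A *-homomorphism that kills a nonzero element of a simple summand kills the summand. -/
theorem map_single_eq_zero (φ : MatrixSum n →⋆ₙₐ[ℂ] MatrixSum m) {j : Fin k}
    {a : Matrix (Fin (n j)) (Fin (n j)) ℂ} (ha : a ≠ 0) (h : φ (Pi.single j a) = 0)
    (b : Matrix (Fin (n j)) (Fin (n j)) ℂ) : φ (Pi.single j b) = 0 := by
  have : Nonempty (Fin (n j)) := by
    by_contra hne
    rw [not_nonempty_iff] at hne
    exact ha (Subsingleton.elim _ _)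
  let f : Matrix (Fin (n j)) (Fin (n j)) ℂ →ₙ+* MatrixSum m :=
    { toFun := fun b => φ (Pi.single j b)
      map_mul' := fun x y => by rw [Pi.single_mul, map_mul]
      map_zero' := by simp
      map_add' := fun x y => by rw [Pi.single_add, map_add] }
  -- A nonempty full matrix ring over a field is simple, and the kernel contains `a ≠ 0`.
  have hf : TwoSidedIdeal.ker f = ⊤ := by
    refine (eq_bot_or_eq_top (TwoSidedIdeal.ker f)).resolve_left fun hbot => ha ?_
    have : a ∈ TwoSidedIdeal.ker f := (TwoSidedIdeal.mem_ker f).2 h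
    rwa [hbot, TwoSidedIdeal.mem_bot] at this
  have hb : b ∈ TwoSidedIdeal.ker f := by
    rw [hf]
    trivial
  exact (TwoSidedIdeal.mem_ker f).1 hb

/-- Multiplying by the unit of the `j`-th summand isolates the component `u j` without leaving the
kernel; simplicity does the rest. -/
theorem map_single_eq_zero_of_map_eq_zero (φ : MatrixSum n →⋆ₙₐ[ℂ] MatrixSum m)
    {u : MatrixSum n} (hu : φ u = 0) {j : Fin k} (hj : u j ≠ 0)
    (b : Matrix (Fin (n j)) (Fin (n j)) ℂ) : φ (Pi.single j b) = 0 := by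
  refine map_single_eq_zero φ hj ?_ b
  have h : (Pi.single j (u j) : MatrixSum n) = Pi.single j 1 * u := by
    rw [← Pi.single_mul_left, one_mul]
  rw [h, map_mul, hu, mul_zero]

/-- A nontrivial kernel contains the unit of some summand. The class of that unit goes to `0`, yet
its `j`-th trace is `n j ≠ 0`. -/
theorem injective_of_injective_K0_map (hn : ∀ j, 0 < n j) (φ : MatrixSum n →⋆ₙₐ[ℂ] MatrixSum m)
    (h : Function.Injective (K0.map φ)) : Function.Injective φ := by
  rw [injective_iff_map_eq_zero]
  intro u hu
  by_contra hne
  obtain ⟨j, hj⟩ := Function.ne_iff.1 hne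
  have hp := isStarProjection_piSingle (n := n) (j := j) (IsStarProjection.one _)
  have h0 : K0.cls (ProjInf.single _ hp) = 0 := by
    refine h (K0.trace_injective ?_)
    ext i
    have hφ := map_single_eq_zero_of_map_eq_zero φ hu hj 1
    rw [map_zero, K0.map_cls, K0.trace_cls]
    simp [ProjInf.map, ProjInf.single, Matrix.trace, hφ]
  have h1 := K0.trace_cls_single hp j
  rw [h0] at h1
  simp only [map_zero, Pi.zero_apply, Pi.single_eq_same, Matrix.trace_one, Fintype.card_fin] at h1
  exact (hn j).ne (by exact_mod_cast h1)

/-- A surjective *-homomorphism of finite-dimensional C*-algebras splits. -/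
theorem exists_rightInverse_of_surjective (φ : MatrixSum n →⋆ₙₐ[ℂ] MatrixSum m)
    (hφ : Function.Surjective φ) :
    ∃ ψ : MatrixSum m →⋆ₙₐ[ℂ] MatrixSum n, φ.comp ψ = NonUnitalStarAlgHom.id ℂ (MatrixSum m) := by
  classical
  -- `z` is the central projection onto the summands that `φ` does not kill. Multiplying by `z` does
  -- not change the image under `φ`, and it annihilates the kernel.
  let z : MatrixSum n := fun j => if φ (Pi.single j 1) = 0 then 0 else 1
  have hz0 {u : MatrixSum n} (hu : φ u = 0) : z * u = 0 := by
    ext1 j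
    by_cases hj : u j = 0
    · simp [hj]
    · simp [z, map_single_eq_zero_of_map_eq_zero φ hu hj]
  have hφz (u : MatrixSum n) : φ (z * u) = φ u := by
    rw [← sub_eq_zero, ← map_sub, ← Finset.univ_sum_single (z * u - u), map_sum]
    refine Finset.sum_eq_zero fun j _ => ?_
    by_cases hj : φ (Pi.single j 1) = 0
    · have : (Pi.single j ((z * u - u) j) : MatrixSum n) = Pi.single j 1 * (z * u - u) := by
        rw [← Pi.single_mul_left, one_mul]
      rw [this, map_mul, hj, zero_mul]
    · simp [z, hj]
  have hzz : z * z = z := by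
    ext1 j
    by_cases hj : φ (Pi.single j 1) = 0 <;> simp [z, hj]
  have hzs : star z = z := by
    ext1 j
    by_cases hj : φ (Pi.single j 1) = 0 <;> simp [z, hj]
  have hzc (u : MatrixSum n) : u * z = z * u := by
    ext1 j
    by_cases hj : φ (Pi.single j 1) = 0 <;> simp [z, hj]
  let s := Function.surjInv hφ
  have hs (b) : φ (s b) = b := Function.surjInv_eq hφ b
  -- Hence `z * s b` does not depend on the preimage `s b`, which makes this set-theoretic section a
  -- *-homomorphism.
  have key {u v : MatrixSum n} (h : φ u = φ v) : z * u = z * v := by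
    rw [← sub_eq_zero, ← mul_sub]
    exact hz0 (by rw [map_sub, h, sub_self])
  refine ⟨{ toFun := fun b => z * s b
            map_smul' := fun c b => ?_
            map_zero' := hz0 (hs 0)
            map_add' := fun a b => ?_
            map_mul' := fun a b => ?_
            map_star' := fun a => ?_ }, ?_⟩
  · change z * s (c • b) = c • (z * s b)
    rw [← mul_smul_comm]
    exact key (by rw [map_smul, hs, hs])
  · rw [← mul_add]
    exact key (by rw [map_add, hs, hs, hs])
  · have : z * s a * (z * s b) = z * (s a * s b) := by
      rw [mul_assoc, ← mul_assoc (s a), hzc, mul_assoc, ← mul_assoc z z, hzz]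
    change z * s (a * b) = z * s a * (z * s b)
    rw [this]
    exact key (by rw [map_mul, hs, hs, hs])
  · rw [star_mul, hzs, hzc]
    exact key (by rw [map_star, hs, hs])
  · ext1 b
    change φ (z * s b) = b
    rw [hφz, hs]

theorem surjective_K0_map_of_surjective (φ : MatrixSum n →⋆ₙₐ[ℂ] MatrixSum m)
    (hφ : Function.Surjective φ) : Function.Surjective (K0.map φ) := by
  obtain ⟨ψ, hψ⟩ := exists_rightInverse_of_surjective φ hφ
  intro x
  refine ⟨K0.map ψ x, ?_⟩
  rw [← AddMonoidHom.comp_apply, ← K0.map_comp, hψ, K0.map_id, AddMonoidHom.id_apply]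

/-- Conjugation by a unitary preserves the trace, and the diagonal form contains `E i j` copies of
`u j`. -/
theorem IsMultiplicityMatrix.trace_eq {φ : MatrixSum n →⋆ₙₐ[ℂ] MatrixSum m}
    {E : Matrix (Fin l) (Fin k) ℕ} (hE : IsMultiplicityMatrix φ E) (u : MatrixSum n) (i : Fin l) :
    (φ u i).trace = ∑ j, (E i j : ℂ) * (u j).trace := by
  obtain ⟨ν, hν, h⟩ := hE
  obtain ⟨s, e, he⟩ := h i
  have hν' : star (ν i) * ν i = 1 := congrFun (Unitary.mem_iff.1 hν).1 i
  have h1 : (ν i * φ u i * star (ν i)).trace = (φ u i).trace := by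
    rw [Matrix.trace_mul_comm, ← mul_assoc, hν', one_mul]
  rw [← h1, he u, Matrix.reindex_apply]
  simp only [Matrix.trace, Matrix.diag_apply, Matrix.submatrix_apply]
  rw [Equiv.sum_comp e.symm (fun x => Matrix.fromBlocks (Matrix.blockDiagonal' fun j =>
    Matrix.blockDiagonal fun _ : Fin (E i j) => u j) 0 0 0 x x)]
  simp [Fintype.sum_sum_type, Fintype.sum_sigma, Fintype.sum_prod_type,
    Matrix.blockDiagonal'_apply, Matrix.blockDiagonal_apply, Finset.mul_sum]

theorem IsMultiplicityMatrix.trace_K0_map {φ : MatrixSum n →⋆ₙₐ[ℂ] MatrixSum m}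
    {E : Matrix (Fin l) (Fin k) ℕ} (hE : IsMultiplicityMatrix φ E) (x : K0 (MatrixSum n))
    (i : Fin l) : K0.trace m (K0.map φ x) i = ∑ j, (E i j : ℂ) * K0.trace n x j := by
  have key (p : ProjInf (MatrixSum n)) : K0.trace m (K0.map φ (K0.cls p)) i =
      ∑ j, (E i j : ℂ) * K0.trace n (K0.cls p) j := by
    rw [K0.map_cls, K0.trace_cls]
    simp only [K0.trace_cls]
    rw [← hE.trace_eq]
    exact congrArg (fun b : MatrixSum m => (b i).trace) (map_sum φ _ _).symm
  obtain ⟨p, q, rfl⟩ := K0.exists_eq_sub x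
  simp only [map_sub, Pi.sub_apply, key, mul_sub, Finset.sum_sub_distrib]

/-- Under the identifications `K₀(A) = ℤ^k` and `K₀(B) = ℤ^ℓ`, the homomorphism `K₀(φ)` is given by
the multiplicity matrix of `φ`. -/
theorem IsMultiplicityMatrix.exists_equiv (hn : ∀ j, 0 < n j) (hm : ∀ i, 0 < m i)
    {φ : MatrixSum n →⋆ₙₐ[ℂ] MatrixSum m} {E : Matrix (Fin l) (Fin k) ℕ}
    (hE : IsMultiplicityMatrix φ E) :
    ∃ (S : (Fin k → ℤ) ≃+ K0 (MatrixSum n)) (T : (Fin l → ℤ) ≃+ K0 (MatrixSum m)),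
      ∀ z, K0.map φ (S z) = T ((E.map (fun a : ℕ => (a : ℤ))).mulVec z) := by
  obtain ⟨S, hS⟩ := K0.exists_equiv hn
  obtain ⟨T, hT⟩ := K0.exists_equiv hm
  refine ⟨S, T, fun z => K0.trace_injective ?_⟩
  ext i
  rw [hE.trace_K0_map, hT]
  simp [hS, Matrix.mulVec, dotProduct]

theorem isAddTorsionFree_quotient_iff {G : Type*} [AddCommGroup G] (H : AddSubgroup G) :
    IsAddTorsionFree (G ⧸ H) ↔ ∀ (a : ℤ) (y : G), a ≠ 0 → a • y ∈ H → y ∈ H := by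
  rw [← Module.isTorsionFree_int_iff_isAddTorsionFree, Module.isTorsionFree_iff_smul_eq_zero]
  constructor
  · intro h a y ha hy
    have := h (r := a) (m := (y : G ⧸ H))
    rw [← QuotientAddGroup.mk_zsmul, QuotientAddGroup.eq_zero_iff,
      QuotientAddGroup.eq_zero_iff] at this
    exact (this hy).resolve_left ha
  · intro h a q hq
    obtain ⟨y, rfl⟩ := QuotientAddGroup.mk_surjective q
    rw [← QuotientAddGroup.mk_zsmul, QuotientAddGroup.eq_zero_iff] at hq
    rw [QuotientAddGroup.eq_zero_iff]
    exact or_iff_not_imp_left.2 fun ha => h a y ha hq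

/-- For an injective `K₀(φ)`: torsion-freeness of the cokernel, coprimality of the full minors of
the multiplicity matrix, and left invertibility of the multiplicity matrix are equivalent. -/
theorem IsMultiplicityMatrix.tfae (hn : ∀ j, 0 < n j) (hm : ∀ i, 0 < m i)
    {φ : MatrixSum n →⋆ₙₐ[ℂ] MatrixSum m} {E : Matrix (Fin l) (Fin k) ℕ}
    (hE : IsMultiplicityMatrix φ E) (hφ : Function.Injective (K0.map φ)) :
    List.TFAE
      [IsAddTorsionFree (K0 (MatrixSum m) ⧸ (K0.map φ).range),
        gcdFullMinors (E.map (fun a : ℕ => (a : ℤ))) = 1,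
        ∃ K : Matrix (Fin k) (Fin l) ℤ, K * E.map (fun a : ℕ => (a : ℤ)) = 1] := by
  obtain ⟨S, T, hST⟩ := hE.exists_equiv hn hm
  generalize E.map (fun a : ℕ => (a : ℤ)) = F at hST ⊢
  have hinj : Function.Injective F.mulVec := fun x y h =>
    S.injective (hφ (by rw [hST, hST, h]))
  -- Injectivity forces `k ≤ l`, so the full minors are those using every column.
  have hkl : k ≤ l := by
    have := LinearMap.finrank_le_finrank_of_injective (f := F.mulVecLin) hinj
    simpa using this
  have hrange (y : Fin l → ℤ) : T y ∈ (K0.map φ).range ↔ ∃ z, y = F.mulVec z := by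
    constructor
    · rintro ⟨x, hx⟩
      refine ⟨S.symm x, T.injective ?_⟩
      rw [← hST, AddEquiv.apply_symm_apply, hx]
    · rintro ⟨z, rfl⟩
      exact ⟨S z, hST z⟩
  have htf : IsAddTorsionFree (K0 (MatrixSum m) ⧸ (K0.map φ).range) ↔
      ∀ (a : ℤ) (y : Fin l → ℤ) (x : Fin k → ℤ), a ≠ 0 → a • y = F.mulVec x →
        ∃ z, y = F.mulVec z := by
    rw [isAddTorsionFree_quotient_iff]
    constructor
    · intro h a y x ha hx
      rw [← hrange]
      refine h a _ ha ?_
      rw [← map_zsmul, hrange]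
      exact ⟨x, hx⟩
    · intro h a y ha hy
      obtain ⟨y, rfl⟩ := T.surjective y
      rw [← map_zsmul, hrange] at hy
      obtain ⟨x, hx⟩ := hy
      exact (hrange y).2 (h a y x ha hx)
  rw [htf]
  tfae_have 1 → 3 := Matrix.exists_mul_eq_one_of_smul_mem_range hinj
  tfae_have 3 → 2 := fun ⟨_, hK⟩ => gcdFullMinors_eq_one_of_mul_eq_one hkl hK
  tfae_have 2 → 1 := fun h _ _ _ ha hx => exists_eq_mulVec_of_gcdFullMinors_eq_one hkl h ha hx
  tfae_finish

end KTheory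

theorem theorem3 {k l : ℕ} (n : Fin k → ℕ) (m : Fin l → ℕ)
    (hn : ∀ j, 0 < n j) (hm : ∀ i, 0 < m i)
    (φ : KTheory.MatrixSum n →⋆ₙₐ[ℂ] KTheory.MatrixSum m) :
    (Function.Injective (KTheory.K0.map φ) → Function.Injective φ) ∧
    (Function.Surjective φ → Function.Surjective (KTheory.K0.map φ)) ∧
    (∀ E : Matrix (Fin l) (Fin k) ℕ, KTheory.IsMultiplicityMatrix φ E →
      Function.Injective (KTheory.K0.map φ) →
      List.TFAE
        [IsAddTorsionFree
            (KTheory.K0 (KTheory.MatrixSum m) ⧸ (KTheory.K0.map φ).range),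
          KTheory.gcdFullMinors (E.map (fun a : ℕ => (a : ℤ))) = 1,
          ∃ K : Matrix (Fin k) (Fin l) ℤ, K * E.map (fun a : ℕ => (a : ℤ)) = 1]) := by
  exact ⟨KTheory.injective_of_injective_K0_map hn φ,
    KTheory.surjective_K0_map_of_surjective φ, fun _ hE => hE.tfae hn hm⟩
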